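/- **Proposition 3.5.** Let $X$ be a discrete set, $m:X\to(0,\infty)$, and let $\ell^p=\ell^p(X,m)$ be the space of functions $f:X\to\mathbb{C}$ with $\|f\|_p^p=\sum_{x\in X} m(x)|f(x)|^p<\infty$. Let $(b,o,c)$ be a magnetic Schrödinger graph over $(X,m)$, that is: $b:X\times X\to[0,\infty)$ is symmetric with zero diagonal and $\sum_{y}b(x,y)<\infty$ for all $x\in X$; $o:X\times X\to\{z\in\mathbb{C}:|z|=1\}$ satisfies $o(x,y)=\overline{o(y,x)}$ for all $x,y\in X$; and $c:X\to\mathbb{R}$. Assume that the form $$Q(\varphi,\psi)=\frac12\sum_{x,y\in X}b(x,y)\bigl(\varphi(x)-o(x,y)\varphi(y)\bigr)\overline{\bigl(\psi(x)-o(x,y)\psi(y)\bigr)}+\sum_{x\in X}c(x)\varphi(x)\overline{\psi(x)}$$ on the finitely supported functions is positive ($Q(\varphi,\varphi)\ge 0$ for all $\varphi$) and closable on $\ell^2$. Let $H$ be the positive self-adjoint operator on $\ell^2$ associated with the closure of $Q$, and let $S_2(t)=\mathrm{e}^{-tH}$, $t\ge 0$, be the strongly continuous semigroup on $\ell^2$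 generated by $-H$. Assume that $b$ is locally finite, i.e. $\{y\in X: b(x,y)>0\}$ is finite for every $x\in X$, and that $S_2$ extends consistently to a strongly continuous semigroup $S_1$ on $\ell^1$, i.e. $S_1(t)f=S_2(t)f$ for all $f\in\ell^1\cap\ell^2$ and $t\ge0$. Assume further that there is $K\in\mathbb{R}$ such that $$\|S_1(t)\omega\|_1\le \mathrm{e}^{tK}\|\omega\|_1\qquad\text{for all }\omega\in\ell^1,\ t\ge0.$$ Then, for all $x\in X$, $$\frac{c(x)}{m(x)}\ge -K.$$ -/

import Mathlib

open Filter Topology MeasureTheory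
open scoped NNReal ENNReal ComplexConjugate

/-- A magnetic Schrödinger graph `(b, o, c)` over the discrete measure space `(X, m)`. -/
structure MagneticSchrodingerGraph (X : Type*) where
  /-- the weight of a vertex -/
  m : X → ℝ
  /-- the edge weights -/
  b : X → X → ℝ
  /-- the magnetic potential -/
  o : X → X → ℂ
  /-- the electric potential -/
  c : X → ℝ
  m_pos : ∀ x, 0 < m x
  b_nonneg : ∀ x y, 0 ≤ b x y
  b_symm : ∀ x y, b x y = b y x
  b_diag : ∀ x, b x x = 0
  b_summable : ∀ x, Summable (fun y => b x y)
  o_norm : ∀ x y, ‖o x y‖ = 1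
  o_symm : ∀ x y, o x y = conj (o y x)

namespace MagneticSchrodingerGraph

variable {X : Type*} (G : MagneticSchrodingerGraph X)

/-- Every vertex has only finitely many neighbours. -/
def LocallyFinite : Prop := ∀ x, {y | 0 < G.b x y}.Finite

/-- The magnetic gradient `∇ₒ f (x, y) = f x - o (x, y) f y`. -/
noncomputable def grad (f : X → ℂ) (x y : X) : ℂ := f x - G.o x y * f y

/-- The sesquilinear form
`Q (φ, ψ) = 1/2 ∑_{x, y} b (x, y) ∇ₒ φ (x, y) conj (∇ₒ ψ (x, y)) + ∑ₓ c x φ x conj (ψ x)`,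
linear in the first argument. It is only used for finitely supported `φ` and `ψ`, where both
sums converge absolutely. -/
noncomputable def form (φ ψ : X → ℂ) : ℂ :=
  (1 / 2) * ∑' p : X × X, (G.b p.1 p.2 : ℂ) * G.grad φ p.1 p.2 * conj (G.grad ψ p.1 p.2)
    + ∑' x, (G.c x : ℂ) * φ x * conj (ψ x)

/-- `Q` is positive: `Q (φ, φ) ≥ 0` for finitely supported `φ` (the number `Q (φ, φ)` is real). -/
def FormPositive : Prop :=
  ∀ φ : X → ℂ, (Function.support φ).Finite → 0 ≤ (G.form φ φ).re

variable [MeasurableSpace X]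

/-- The measure `A ↦ ∑_{x ∈ A} m x`. -/
noncomputable def measure : Measure X :=
  Measure.sum (fun x => ENNReal.ofReal (G.m x) • Measure.dirac x)

/-- The complex space `ℓ^p (X, m)`. All points have positive mass, so on a discrete measurable
space the almost everywhere classes are just functions on `X`. -/
abbrev ell (p : ℝ≥0∞) : Type _ := Lp ℂ p G.measure

/-- A sequence of finitely supported functions that is Cauchy for the form `Q`. -/
structure IsFormCauchy (φ : ℕ → G.ell 2) : Prop where
  finite_support : ∀ n, (Function.support (φ n)).Finite
  cauchy : Tendsto (fun p : ℕ × ℕ => (G.form ⇑(φ p.1 - φ p.2) ⇑(φ p.1 - φ p.2)).re)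
    atTop (𝓝 0)

/-- `Q`, with the finitely supported functions as its domain, is closable on `ℓ²`. -/
def FormClosable : Prop :=
  ∀ φ : ℕ → G.ell 2, G.IsFormCauchy φ → Tendsto φ atTop (𝓝 0) →
    Tendsto (fun n => (G.form (φ n) (φ n)).re) atTop (𝓝 0)

/-- `φ` is a sequence of finitely supported functions that is Cauchy for `Q` and converges to `f`
in `ℓ²`, i.e. an admissible approximation of `f` in the construction of the closure of `Q`. -/
def FormApprox (φ : ℕ → G.ell 2) (f : G.ell 2) : Prop :=
  G.IsFormCauchy φ ∧ Tendsto φ atTop (𝓝 f)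

/-- The domain `D(Q)` of the closure of `Q`. -/
def formDomain : Set (G.ell 2) := {f | ∃ φ, G.FormApprox φ f}

/-- The closure of `Q` takes the value `z` at `(f, g)`, where `f` and `g` lie in `D(Q)`. -/
def ClosedFormEq (f g : G.ell 2) (z : ℂ) : Prop :=
  f ∈ G.formDomain ∧ g ∈ G.formDomain ∧
    ∀ φ ψ, G.FormApprox φ f → G.FormApprox ψ g →
      Tendsto (fun n => G.form (φ n) (ψ n)) atTop (𝓝 z)

/-- The graph of the operator `H` on `ℓ²` associated with the closure of `Q`: `f ∈ D(H)` and
`H f = h` if and only if `f ∈ D(Q)` and `Q (f, g) = ⟨h, g⟩` for all `g ∈ D(Q)`. Mathlib's inner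
product is linear in the second argument, so `⟨h, g⟩ = ∑ₓ m h conj g` is `inner ℂ g h`. -/
def operatorGraph : Set (G.ell 2 × G.ell 2) :=
  {q | q.1 ∈ G.formDomain ∧ ∀ g ∈ G.formDomain, G.ClosedFormEq q.1 g (inner ℂ g q.2)}

end MagneticSchrodingerGraph

/-- Strongly continuous one-parameter semigroups of bounded operators. -/
structure IsC0Semigroup {E : Type*} [NormedAddCommGroup E] [NormedSpace ℂ E]
    (S : ℝ≥0 → E →L[ℂ] E) : Prop where
  map_zero : S 0 = ContinuousLinearMap.id ℂ E
  map_add : ∀ s t, S (s + t) = (S s).comp (S t)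
  continuous : ∀ f, Continuous (fun t => S t f)

/-- The graph of the generator of a semigroup: the pairs `(f, h)` such that
`(S t f - f) / t` tends to `h` as `t` tends to `0` from above. -/
def generatorGraph {E : Type*} [NormedAddCommGroup E] [NormedSpace ℂ E]
    (S : ℝ≥0 → E →L[ℂ] E) : Set (E × E) :=
  {q | Tendsto (fun t : ℝ≥0 => ((t : ℝ)⁻¹ : ℂ) • (S t q.1 - q.1)) (𝓝[>] 0) (𝓝 q.2)}

namespace MagneticSchrodingerGraph

variable {X : Type*} [MeasurableSpace X] (G : MagneticSchrodingerGraph X)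

/-- `S` is the semigroup `t ↦ exp (- t H)` on `ℓ²`, i.e. the strongly continuous semigroup whose
generator is `-H` (a strongly continuous semigroup is determined by its generator). -/
def IsSchrodingerSemigroup (S : ℝ≥0 → G.ell 2 →L[ℂ] G.ell 2) : Prop :=
  IsC0Semigroup S ∧ ∀ f h, (f, h) ∈ generatorGraph S ↔ (f, -h) ∈ G.operatorGraph

/-- `S₁` on `ℓ¹` is consistent with `S₂` on `ℓ²`: they agree on `ℓ¹ ∩ ℓ²` at all times. -/
def Consistent (S₁ : ℝ≥0 → G.ell 1 →L[ℂ] G.ell 1) (S₂ : ℝ≥0 → G.ell 2 →L[ℂ] G.ell 2) : Prop :=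
  ∀ t (f₁ : G.ell 1) (f₂ : G.ell 2), (∀ x, f₁ x = f₂ x) → ∀ x, S₁ t f₁ x = S₂ t f₂ x

end MagneticSchrodingerGraph

/-! Test the growth bound on the indicator δ of a vertex x and differentiate at t = 0. By local
finiteness `H` δ is explicit and finitely supported (`form_single_left`), and closability with
Cauchy-Schwarz puts δ in D(H) (`mem_operatorGraph`).

Keep only x and its neighbours in the ℓ¹ norm of the evolved δ, subtract m(x), divide by t and let t
→ 0. The real part at x contributes -(∑ b(x,y) + c(x)). At a neighbour y, δ vanishes, so the
weighted modulus contributes b(x,y), the phase being lost. The edge weights cancel, leaving -c(x),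
while the bound tends to m(x) K. -/

namespace MagneticSchrodingerGraph

/-! ### Algebra of the form on finitely supported functions -/

section Form

variable {X : Type*} (G : MagneticSchrodingerGraph X)

variable {G} in
theorem m_ne_zero (x : X) : (G.m x : ℂ) ≠ 0 := by exact_mod_cast (G.m_pos x).ne'

theorem form_conj (φ ψ : X → ℂ) : conj (G.form φ ψ) = G.form ψ φ := by
  unfold form
  simp only [map_add, map_mul, Complex.conj_tsum, Complex.conj_ofReal, Complex.conj_conj,
    map_div₀, map_one, map_ofNat]
  congr 2
  · congr 1
    funext p
    ring
  · funext x
    ring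

-- An edge contributes only if one endpoint lies in the support, and each vertex has finitely many
-- edges. This gives the summability needed for additivity of `form`.
variable {G} in
theorem LocallyFinite.finite_support_mul_grad (hfin : G.LocallyFinite) {φ : X → ℂ}
    (hφ : (Function.support φ).Finite) :
    (Function.support fun p : X × X => (G.b p.1 p.2 : ℂ) * G.grad φ p.1 p.2).Finite := by
  have h1 : (⋃ x ∈ Function.support φ, Prod.mk x '' {y | 0 < G.b x y}).Finite :=
    hφ.biUnion fun x _ => (hfin x).image _
  have h2 : (⋃ x ∈ Function.support φ, (fun y => (y, x)) '' {y | 0 < G.b x y}).Finite :=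
    hφ.biUnion fun x _ => (hfin x).image _
  refine (h1.union h2).subset ?_
  rintro ⟨x, y⟩ h
  simp only [Function.mem_support, ne_eq, mul_eq_zero, not_or, Complex.ofReal_eq_zero] at h
  have hb : 0 < G.b x y := lt_of_le_of_ne (G.b_nonneg x y) (Ne.symm h.1)
  by_cases hx : φ x = 0
  · have hy : φ y ≠ 0 := by
      intro hy
      exact h.2 (by simp [grad, hx, hy])
    right
    simp only [Set.mem_iUnion]
    exact ⟨y, hy, x, by simpa [G.b_symm y x] using hb, rfl⟩
  · left
    simp only [Set.mem_iUnion]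
    exact ⟨x, hx, y, hb, rfl⟩

theorem grad_add (φ φ' : X → ℂ) (x y : X) :
    G.grad (φ + φ') x y = G.grad φ x y + G.grad φ' x y := by
  simp only [grad, Pi.add_apply]
  ring

theorem grad_smul (r : ℂ) (φ : X → ℂ) (x y : X) :
    G.grad (r • φ) x y = r * G.grad φ x y := by
  simp only [grad, Pi.smul_apply, smul_eq_mul]
  ring

variable {G} in
theorem LocallyFinite.form_add_left (hfin : G.LocallyFinite) {φ φ' : X → ℂ}
    (hφ : (Function.support φ).Finite) (hφ' : (Function.support φ').Finite) (ψ : X → ℂ) :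
    G.form (φ + φ') ψ = G.form φ ψ + G.form φ' ψ := by
  have s1 : ∀ {f : X → ℂ}, (Function.support f).Finite → Summable fun p : X × X =>
      (G.b p.1 p.2 : ℂ) * G.grad f p.1 p.2 * conj (G.grad ψ p.1 p.2) := fun hf =>
    summable_of_hasFiniteSupport ((hfin.finite_support_mul_grad hf).subset
      (Function.support_mul_subset_left _ _))
  have s2 : ∀ {f : X → ℂ}, (Function.support f).Finite → Summable fun x : X =>
      (G.c x : ℂ) * f x * conj (ψ x) := fun hf =>
    summable_of_hasFiniteSupport (hf.subset fun x hx hx0 => hx (by simp [hx0]))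
  unfold form
  simp only [grad_add, Pi.add_apply, mul_add, add_mul]
  rw [(s1 hφ).tsum_add (s1 hφ'), (s2 hφ).tsum_add (s2 hφ')]
  ring

theorem form_smul_left (r : ℂ) (φ ψ : X → ℂ) : G.form (r • φ) ψ = r * G.form φ ψ := by
  have h1 : ∀ p : X × X, (G.b p.1 p.2 : ℂ) * G.grad (r • φ) p.1 p.2 * conj (G.grad ψ p.1 p.2) =
      r * ((G.b p.1 p.2 : ℂ) * G.grad φ p.1 p.2 * conj (G.grad ψ p.1 p.2)) := fun p => by
    rw [grad_smul]
    ring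
  have h2 : ∀ x, (G.c x : ℂ) * (r • φ) x * conj (ψ x) = r * ((G.c x : ℂ) * φ x * conj (ψ x)) :=
    fun x => by
      rw [Pi.smul_apply, smul_eq_mul]
      ring
  simp only [form, h1, h2, tsum_mul_left]
  ring

/-- The form as a positive semidefinite inner product on the finitely supported functions. -/
noncomputable abbrev formCore (hfin : G.LocallyFinite) (hpos : G.FormPositive) :
    PreInnerProductSpace.Core ℂ (X →₀ ℂ) where
  inner φ ψ := G.form ψ φ
  conj_inner_symm φ ψ := G.form_conj _ _
  re_inner_nonneg φ := hpos φ φ.hasFiniteSupport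
  add_left φ φ' ψ := by
    rw [← form_conj, Finsupp.coe_add, hfin.form_add_left φ.hasFiniteSupport φ'.hasFiniteSupport,
      map_add, form_conj, form_conj]
  smul_left φ ψ r := by
    rw [← form_conj, Finsupp.coe_smul, form_smul_left, map_mul, form_conj]

variable {G} in
theorem FormPositive.norm_form_sq_le (hpos : G.FormPositive) (hfin : G.LocallyFinite)
    {φ ψ : X → ℂ} (hφ : (Function.support φ).Finite) (hψ : (Function.support ψ).Finite) :
    ‖G.form φ ψ‖ ^ 2 ≤ (G.form φ φ).re * (G.form ψ ψ).re := by
  let := G.formCore hfin hpos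
  have h : ‖G.form φ ψ‖ * ‖G.form ψ φ‖ ≤ (G.form ψ ψ).re * (G.form φ φ).re :=
    InnerProductSpace.Core.inner_mul_inner_self_le (𝕜 := ℂ)
      (Finsupp.ofSupportFinite ψ hψ) (Finsupp.ofSupportFinite φ hφ)
  rw [← G.form_conj φ ψ, Complex.norm_conj] at h
  rw [sq, mul_comm (G.form φ φ).re]
  exact h

variable {G} in
theorem LocallyFinite.form_add_self (hfin : G.LocallyFinite) {φ ψ : X → ℂ}
    (hφ : (Function.support φ).Finite) (hψ : (Function.support ψ).Finite) :
    (G.form (φ + ψ) (φ + ψ)).re =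
      (G.form φ φ).re + 2 * (G.form φ ψ).re + (G.form ψ ψ).re := by
  have h : ∀ f : X → ℂ, (G.form f (φ + ψ)) = G.form f φ + G.form f ψ := fun f => by
    rw [← form_conj, hfin.form_add_left hφ hψ, map_add, form_conj, form_conj]
  rw [hfin.form_add_left hφ hψ, h, h, ← G.form_conj φ ψ]
  simp only [Complex.add_re, Complex.conj_re]
  ring

-- The cross term is controlled by Cauchy-Schwarz and the arithmetic-geometric mean inequality.
variable {G} in
theorem FormPositive.form_add_self_le (hpos : G.FormPositive) (hfin : G.LocallyFinite)
    {φ ψ : X → ℂ} (hφ : (Function.support φ).Finite) (hψ : (Function.support ψ).Finite) :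
    (G.form (φ + ψ) (φ + ψ)).re ≤ 2 * (G.form φ φ).re + 2 * (G.form ψ ψ).re := by
  have h1 := hpos.norm_form_sq_le hfin hφ hψ
  have h2 := Complex.re_le_norm (G.form φ ψ)
  rw [hfin.form_add_self hφ hψ]
  have h3 := hpos φ hφ
  have h4 := hpos ψ hψ
  have h5 : ‖G.form φ ψ‖ ≤ ((G.form φ φ).re + (G.form ψ ψ).re) / 2 := by
    apply abs_le_of_sq_le_sq' _ (by positivity) |>.2
    nlinarith [sq_nonneg ((G.form φ φ).re - (G.form ψ ψ).re)]
  linarith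

variable {G} in
/-- The set of neighbours of a vertex. -/
noncomputable def LocallyFinite.neighbors (hfin : G.LocallyFinite) (x : X) : Finset X :=
  (hfin x).toFinset

variable {G} in
theorem LocallyFinite.not_mem_neighbors_self (hfin : G.LocallyFinite) (x : X) :
    x ∉ hfin.neighbors x := by
  simp [neighbors, G.b_diag]

variable {G} in
theorem LocallyFinite.b_eq_zero (hfin : G.LocallyFinite) {x y : X}
    (h : y ∉ hfin.neighbors x) : G.b x y = 0 := by
  simp only [neighbors, Set.Finite.mem_toFinset, Set.mem_ofPred_eq, not_lt] at h
  exact le_antisymm h (G.b_nonneg x y)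

-- Only edges at x matter. Each occurs in both orientations with equal contributions because `o` is
-- unimodular, which absorbs the factor 1/2.
open Classical in
variable {G} in
theorem LocallyFinite.form_single_left (hfin : G.LocallyFinite) (x : X) (ψ : X → ℂ) :
    G.form (Pi.single x 1) ψ =
      ((∑ y ∈ hfin.neighbors x, (G.b x y : ℂ)) + G.c x) * conj (ψ x)
        - ∑ y ∈ hfin.neighbors x, (G.b x y : ℂ) * G.o y x * conj (ψ y) := by
  have hx := hfin.not_mem_neighbors_self x
  set N := hfin.neighbors x with hN
  have hc : ∑' y, (G.c y : ℂ) * (Pi.single x 1 : X → ℂ) y * conj (ψ y) =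
      G.c x * conj (ψ x) := by
    rw [tsum_eq_single x fun y hy => by simp [hy]]
    simp
  have hdisj : Disjoint (N.image (Prod.mk x)) (N.image fun y => (y, x)) := by
    rw [Finset.disjoint_left]
    intro p hp hp'
    obtain ⟨y, hy, rfl⟩ := Finset.mem_image.1 hp
    obtain ⟨z, hz, hzy⟩ := Finset.mem_image.1 hp'
    obtain ⟨rfl, rfl⟩ := Prod.mk.inj hzy
    exact hx hz
  have hb : ∑' p : X × X, (G.b p.1 p.2 : ℂ) * G.grad (Pi.single x 1) p.1 p.2 *
      conj (G.grad ψ p.1 p.2) =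
      ∑ y ∈ N, 2 * ((G.b x y : ℂ) * conj (ψ x) - G.b x y * G.o y x * conj (ψ y)) := by
    rw [tsum_eq_sum (s := N.image (Prod.mk x) ∪ N.image fun y => (y, x)),
      Finset.sum_union hdisj, Finset.sum_image (by simp), Finset.sum_image (by simp),
      ← Finset.sum_add_distrib]
    · refine Finset.sum_congr rfl fun y hy => ?_
      have hyx : y ≠ x := ne_of_mem_of_not_mem hy hx
      have ho : G.o x y = conj (G.o y x) := G.o_symm x y
      have ho1 : G.o y x * conj (G.o y x) = 1 := by
        rw [Complex.mul_conj, Complex.normSq_eq_norm_sq, G.o_norm]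
        simp
      simp only [grad, Pi.single_eq_same, Pi.single_eq_of_ne hyx, map_sub, map_mul, ho,
        Complex.conj_conj, G.b_symm y x]
      linear_combination (G.b x y : ℂ) * conj (ψ x) * ho1
    · rintro ⟨y, z⟩ hp
      simp only [Finset.mem_union, Finset.mem_image, Prod.mk.injEq, not_or, not_exists,
        not_and] at hp
      by_cases hy : y = x
      · subst hy
        have : G.b y z = 0 := hfin.b_eq_zero fun h => hp.1 z h rfl rfl
        simp [this]
      · by_cases hz : z = x
        · subst hz
          have : G.b y z = 0 := by
            rw [G.b_symm]
            exact hfin.b_eq_zero fun h => hp.2 y h rfl rfl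
          simp [this]
        · simp [grad, hy, hz]
  unfold form
  rw [hb, hc, ← Finset.mul_sum, Finset.sum_sub_distrib, ← Finset.sum_mul]
  ring

end Form

/-! ### Point evaluations and indicators in ℓ¹ and ℓ² -/

section Ell

variable {X : Type*} [MeasurableSpace X] [DiscreteMeasurableSpace X]
  (G : MagneticSchrodingerGraph X)

theorem measure_singleton (x : X) : G.measure {x} = ENNReal.ofReal (G.m x) := by
  rw [measure, Measure.sum_apply _ (MeasurableSet.of_discrete), tsum_eq_single x]
  · simp
  · intro y hy
    simp [hy]

theorem measure_singleton_ne_top (x : X) : G.measure {x} ≠ ∞ := by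
  simp [measure_singleton]

theorem measureReal_singleton (x : X) : G.measure.real {x} = G.m x := by
  rw [Measure.real, measure_singleton, ENNReal.toReal_ofReal (G.m_pos x).le]

-- Every point has positive mass, so the only null set is empty.
variable {G} in
theorem forall_of_ae {P : X → Prop} (h : ∀ᵐ x ∂G.measure, P x) (x : X) : P x := by
  by_contra hx
  have h0 : G.measure {x} = 0 := measure_mono_null (by simpa using hx) h
  rw [measure_singleton, ENNReal.ofReal_eq_zero] at h0
  exact absurd (G.m_pos x) (not_lt.2 h0)

/-- The function that is `1` at `x` and vanishes elsewhere, as an element of `ℓ^p`. -/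
noncomputable def delta (p : ℝ≥0∞) (x : X) : G.ell p :=
  indicatorConstLp p (MeasurableSet.of_discrete (s := {x})) (G.measure_singleton_ne_top x) 1

open Classical in
theorem coe_delta (p : ℝ≥0∞) (x : X) : ⇑(G.delta p x) = Pi.single x (1 : ℂ) := by
  funext y
  rw [delta, forall_of_ae indicatorConstLp_coeFn y]
  simp [Set.indicator_apply, Pi.single_apply]

theorem finite_support_delta (p : ℝ≥0∞) (x : X) :
    (Function.support (G.delta p x)).Finite := by
  classical
  rw [coe_delta]
  exact (Set.finite_singleton x).subset (Pi.support_single_subset)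

variable {G} in
theorem coe_ell_sub {p : ℝ≥0∞} (f g : G.ell p) : ⇑(f - g) = ⇑f - ⇑g :=
  funext (forall_of_ae (Lp.coeFn_sub f g))

theorem norm_delta_one (x : X) : ‖G.delta 1 x‖ = G.m x := by
  rw [delta, norm_indicatorConstLp one_ne_zero ENNReal.one_ne_top, measureReal_singleton]
  simp

theorem inner_delta_left (x : X) (f : G.ell 2) : inner ℂ (G.delta 2 x) f = G.m x * f x := by
  rw [delta, L2.inner_indicatorConstLp_one, integral_singleton, measureReal_singleton,
    Complex.real_smul]

theorem inner_delta_right (x : X) (f : G.ell 2) :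
    inner ℂ f (G.delta 2 x) = G.m x * conj (f x) := by
  rw [← inner_conj_symm, inner_delta_left, map_mul, Complex.conj_ofReal]

theorem sum_mul_norm_le_norm (f : G.ell 1) (s : Finset X) :
    ∑ y ∈ s, G.m y * ‖f y‖ ≤ ‖f‖ := by
  have hi : Integrable (fun y => ‖f y‖) G.measure := (L1.integrable_coeFn f).norm
  have h := setIntegral_le_integral (s := (s : Set X)) hi (ae_of_all _ fun y => norm_nonneg (f y))
  rw [setIntegral_finset s hi.integrableOn, ← L1.norm_eq_integral_norm] at h
  simpa [measureReal_singleton] using h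

end Ell

/-! ### The operator on indicators of vertices -/

section Operator

variable {X : Type*} [MeasurableSpace X] [DiscreteMeasurableSpace X]
  {G : MagneticSchrodingerGraph X}

theorem finite_support_sub {f g : G.ell 2} (hf : (Function.support f).Finite)
    (hg : (Function.support g).Finite) : (Function.support ⇑(f - g)).Finite := by
  rw [coe_ell_sub]
  exact (hf.union hg).subset (Function.support_sub _ _)

theorem isFormCauchy_const {f : G.ell 2} (hf : (Function.support f).Finite) :
    G.IsFormCauchy fun _ => f := by
  refine ⟨fun _ => hf, ?_⟩
  have h : ⇑(f - f) = 0 := by rw [coe_ell_sub, sub_self]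
  have h0 : G.form 0 0 = 0 := by simpa using G.form_smul_left 0 0 0
  simp only [h, h0, Complex.zero_re]
  exact tendsto_const_nhds

theorem IsFormCauchy.sub_const {φ : ℕ → G.ell 2} (hφ : G.IsFormCauchy φ) {f : G.ell 2}
    (hf : (Function.support f).Finite) : G.IsFormCauchy fun n => φ n - f := by
  refine ⟨fun n => finite_support_sub (hφ.finite_support n) hf, ?_⟩
  simpa only [sub_sub_sub_cancel_right] using hφ.cauchy

/-- Compare with one fixed late term `φ M`: the difference has form value below 1. -/
theorem IsFormCauchy.eventually_form_le {φ : ℕ → G.ell 2} (hφ : G.IsFormCauchy φ)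
    (hpos : G.FormPositive) (hfin : G.LocallyFinite) :
    ∃ C, ∀ᶠ n in atTop, (G.form (φ n) (φ n)).re ≤ C := by
  have h := hφ.cauchy.eventually (gt_mem_nhds zero_lt_one)
  obtain ⟨⟨N, M⟩, hN⟩ := eventually_atTop.1 h
  refine ⟨2 * 1 + 2 * (G.form (φ M) (φ M)).re, eventually_atTop.2 ⟨N, fun n hn => ?_⟩⟩
  have h1 := hN (n, M) ⟨hn, le_rfl⟩
  have h2 := hpos.form_add_self_le hfin
    (finite_support_sub (hφ.finite_support n) (hφ.finite_support M)) (hφ.finite_support M)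
  have h3 : ⇑(φ n - φ M) + ⇑(φ M) = φ n := by rw [coe_ell_sub, sub_add_cancel]
  rw [h3] at h2
  simp only at h1
  linarith

/-- If `f` and `h` satisfy `Q (f, ψ) = ⟨h, ψ⟩` for all finitely supported `ψ`, and `f` is itself
finitely supported, then `f ∈ D(H)` and `H f = h`. -/
theorem mem_operatorGraph (hpos : G.FormPositive) (hclos : G.FormClosable)
    (hfin : G.LocallyFinite) {f h : G.ell 2} (hf : (Function.support f).Finite)
    (hfh : ∀ ψ : G.ell 2, (Function.support ψ).Finite → G.form f ψ = inner ℂ ψ h) :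
    (f, h) ∈ G.operatorGraph := by
  have hfd : f ∈ G.formDomain := ⟨_, isFormCauchy_const hf, tendsto_const_nhds⟩
  refine ⟨hfd, fun g hg => ⟨hfd, hg, fun φ ψ hφ hψ => ?_⟩⟩
  obtain ⟨C, hC⟩ := hψ.1.eventually_form_le hpos hfin
  -- Since `f` is finitely supported, `φ n - f` is itself a form-Cauchy null sequence, so
  -- closability applies to it; Cauchy-Schwarz against the bounded `ψ n` then kills the error term.
  have hsub := hφ.1.sub_const hf
  have h0 : Tendsto (fun n => φ n - f) atTop (𝓝 0) := by
    simpa using hφ.2.sub_const f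
  have hq := hclos _ hsub h0
  have hzero : Tendsto (fun n => G.form ⇑(φ n - f) (ψ n)) atTop (𝓝 0) := by
    rw [tendsto_zero_iff_norm_tendsto_zero]
    have hsq : Tendsto (fun n => Real.sqrt ((G.form ⇑(φ n - f) ⇑(φ n - f)).re * C)) atTop
        (𝓝 0) := by
      simpa using (hq.mul_const C).sqrt
    refine squeeze_zero' (Eventually.of_forall fun n => norm_nonneg _) ?_ hsq
    filter_upwards [hC] with n hn
    apply Real.le_sqrt_of_sq_le
    exact (hpos.norm_form_sq_le hfin (hsub.finite_support n) (hψ.1.finite_support n)).trans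
      (mul_le_mul_of_nonneg_left hn (hpos _ (hsub.finite_support n)))
  have hin : Tendsto (fun n => inner ℂ (ψ n) h) atTop (𝓝 (inner ℂ g h)) :=
    hψ.2.inner tendsto_const_nhds
  have hadd := hzero.add hin
  rw [zero_add] at hadd
  refine hadd.congr fun n => ?_
  rw [← hfh _ (hψ.1.finite_support n),
    ← hfin.form_add_left (hsub.finite_support n) hf, coe_ell_sub, sub_add_cancel]

/-- The operator `H` applied to the function that is `1` at `x` and vanishes elsewhere. -/
noncomputable def LocallyFinite.operatorDelta (hfin : G.LocallyFinite) (x : X) : G.ell 2 :=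
  (((∑ y ∈ hfin.neighbors x, (G.b x y : ℂ)) + G.c x) / G.m x) • G.delta 2 x
    - ∑ y ∈ hfin.neighbors x, ((G.b x y : ℂ) * G.o y x / G.m y) • G.delta 2 y

theorem delta_mem_operatorGraph (hpos : G.FormPositive) (hclos : G.FormClosable)
    (hfin : G.LocallyFinite) (x : X) :
    (G.delta 2 x, hfin.operatorDelta x) ∈ G.operatorGraph := by
  classical
  refine mem_operatorGraph hpos hclos hfin (G.finite_support_delta 2 x) fun ψ _ => ?_
  rw [coe_delta, hfin.form_single_left, LocallyFinite.operatorDelta, inner_sub_right, inner_sum]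
  simp only [inner_smul_right, inner_delta_right]
  congr 1
  · rw [← mul_assoc, div_mul_cancel₀ _ (m_ne_zero x)]
  · refine Finset.sum_congr rfl fun y _ => ?_
    rw [← mul_assoc, div_mul_cancel₀ _ (m_ne_zero y)]

theorem inner_delta_operatorDelta_self (hfin : G.LocallyFinite) (x : X) :
    inner ℂ (G.delta 2 x) (hfin.operatorDelta x) =
      (∑ y ∈ hfin.neighbors x, (G.b x y : ℂ)) + G.c x := by
  classical
  rw [LocallyFinite.operatorDelta, inner_sub_right, inner_sum,
    Finset.sum_eq_zero (s := hfin.neighbors x) (f := fun y => inner ℂ (G.delta 2 x) _), sub_zero]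
  · rw [inner_smul_right, inner_delta_left, coe_delta, Pi.single_eq_same, mul_one,
      div_mul_cancel₀ _ (m_ne_zero x)]
  · intro y hy
    have hyx : x ≠ y := (ne_of_mem_of_not_mem hy (hfin.not_mem_neighbors_self x)).symm
    rw [inner_smul_right, inner_delta_left, coe_delta, Pi.single_eq_of_ne hyx, mul_zero, mul_zero]

theorem norm_inner_delta_operatorDelta (hfin : G.LocallyFinite) {x y : X}
    (hy : y ∈ hfin.neighbors x) :
    ‖inner ℂ (G.delta 2 y) (hfin.operatorDelta x)‖ = G.b x y := by
  classical
  have hyx : y ≠ x := ne_of_mem_of_not_mem hy (hfin.not_mem_neighbors_self x)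
  rw [LocallyFinite.operatorDelta, inner_sub_right, inner_sum, inner_smul_right,
    inner_delta_left, coe_delta, Pi.single_eq_of_ne hyx, mul_zero, mul_zero, zero_sub, norm_neg,
    Finset.sum_eq_single y]
  · rw [inner_smul_right, inner_delta_left, coe_delta, Pi.single_eq_same, mul_one,
      div_mul_cancel₀ _ (m_ne_zero y), norm_mul, G.o_norm, mul_one, Complex.norm_real,
      Real.norm_of_nonneg (G.b_nonneg x y)]
  · intro z _ hz
    rw [inner_smul_right, inner_delta_left, coe_delta, Pi.single_eq_of_ne hz.symm, mul_zero,
      mul_zero]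
  · exact fun h => absurd hy h

end Operator

end MagneticSchrodingerGraph

/-! ### Differentiating the ℓ¹ bound at time zero -/

open MagneticSchrodingerGraph in
theorem proposition3p5 {X : Type*} [MeasurableSpace X] [DiscreteMeasurableSpace X]
    (G : MagneticSchrodingerGraph X) (hpos : G.FormPositive) (hclos : G.FormClosable)
    (hfin : G.LocallyFinite)
    (S₂ : ℝ≥0 → G.ell 2 →L[ℂ] G.ell 2) (hS₂ : G.IsSchrodingerSemigroup S₂)
    (S₁ : ℝ≥0 → G.ell 1 →L[ℂ] G.ell 1) (hS₁ : IsC0Semigroup S₁)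
    (hcons : G.Consistent S₁ S₂)
    (K : ℝ) (hK : ∀ (ω : G.ell 1) (t : ℝ≥0), ‖S₁ t ω‖ ≤ Real.exp (t * K) * ‖ω‖) :
    ∀ x : X, -K ≤ G.c x / G.m x := by
  classical
  intro x
  set N := hfin.neighbors x with hN
  set q : ℝ≥0 → G.ell 2 := fun t => ((t : ℝ)⁻¹ : ℂ) • (S₂ t (G.delta 2 x) - G.delta 2 x) with hq
  have hlim : Tendsto q (𝓝[>] 0) (𝓝 (-hfin.operatorDelta x)) := by
    refine (hS₂.2 (G.delta 2 x) (-hfin.operatorDelta x)).2 ?_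
    rw [neg_neg]
    exact delta_mem_operatorGraph hpos hclos hfin x
  have hinner : ∀ y, Tendsto (fun t => inner ℂ (G.delta 2 y) (q t)) (𝓝[>] 0)
      (𝓝 (inner ℂ (G.delta 2 y) (-hfin.operatorDelta x))) := fun y =>
    tendsto_const_nhds.inner hlim
  have hL : Tendsto (fun t => (inner ℂ (G.delta 2 x) (q t)).re +
      ∑ y ∈ N, ‖inner ℂ (G.delta 2 y) (q t)‖) (𝓝[>] 0) (𝓝 (-G.c x)) := by
    have h := ((Complex.continuous_re.tendsto _).comp (hinner x)).add
      (tendsto_finsetSum N fun y _ => (hinner y).norm)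
    have hsum : ∑ y ∈ N, ‖inner ℂ (G.delta 2 y) (-hfin.operatorDelta x)‖ = ∑ y ∈ N, G.b x y :=
      Finset.sum_congr rfl fun y hy => by
        rw [inner_neg_right, norm_neg, norm_inner_delta_operatorDelta hfin hy]
    have hlimit : -G.c x = (inner ℂ (G.delta 2 x) (-hfin.operatorDelta x)).re +
        ∑ y ∈ N, ‖inner ℂ (G.delta 2 y) (-hfin.operatorDelta x)‖ := by
      rw [hsum, inner_neg_right, inner_delta_operatorDelta_self, ← hN]
      simp
    rw [hlimit]
    exact h
  -- The quotient is the slope of t ↦ exp(tK) at 0.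
  have hR : Tendsto (fun t : ℝ≥0 => G.m x * ((t : ℝ)⁻¹ * (Real.exp (t * K) - 1))) (𝓝[>] 0)
      (𝓝 (G.m x * K)) := by
    have hd : HasDerivAt (fun t : ℝ => Real.exp (t * K)) K 0 := by
      simpa using ((hasDerivAt_id (0 : ℝ)).mul_const K).exp
    have h := hasDerivAt_iff_tendsto_slope_zero.1 hd
    simp only [zero_add, zero_mul, Real.exp_zero, smul_eq_mul] at h
    refine Tendsto.const_mul _ (h.comp ?_)
    refine tendsto_nhdsWithin_iff.2 ⟨?_, ?_⟩
    · exact (NNReal.continuous_coe.tendsto' 0 0 rfl).mono_left nhdsWithin_le_nhds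
    · filter_upwards [self_mem_nhdsWithin] with t ht
      exact NNReal.coe_ne_zero.2 (ne_of_gt ht)
  have hle : -G.c x ≤ G.m x * K := by
    refine le_of_tendsto_of_tendsto hL hR ?_
    filter_upwards [self_mem_nhdsWithin] with t ht
    have ht0 : (0 : ℝ) < t := NNReal.coe_pos.2 ht
    have hagree : ∀ y, S₁ t (G.delta 1 x) y = S₂ t (G.delta 2 x) y :=
      hcons t _ _ fun y => by rw [coe_delta, coe_delta]
    -- Truncating to a finite set lets the ℓ² limit be taken termwise; the discarded terms are
    -- nonnegative.
    have hnorm := (G.sum_mul_norm_le_norm (S₁ t (G.delta 1 x)) (insert x N)).trans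
      (hK (G.delta 1 x) t)
    rw [Finset.sum_insert (hfin.not_mem_neighbors_self x), norm_delta_one] at hnorm
    simp only [hagree] at hnorm
    have hself : (inner ℂ (G.delta 2 x) (q t)).re =
        (t : ℝ)⁻¹ * (G.m x * (S₂ t (G.delta 2 x) x).re - G.m x) := by
      simp only [hq]
      rw [inner_smul_right, inner_sub_right, inner_delta_left, inner_delta_left, coe_delta,
        Pi.single_eq_same, mul_one, ← Complex.ofReal_inv, Complex.re_ofReal_mul,
        Complex.sub_re, Complex.re_ofReal_mul, Complex.ofReal_re]
    have hother : ∀ y ∈ N, ‖inner ℂ (G.delta 2 y) (q t)‖ =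
        (t : ℝ)⁻¹ * (G.m y * ‖S₂ t (G.delta 2 x) y‖) := by
      intro y hy
      have hyx : y ≠ x := ne_of_mem_of_not_mem hy (hfin.not_mem_neighbors_self x)
      simp only [hq]
      rw [inner_smul_right, inner_sub_right, inner_delta_left, inner_delta_left, G.coe_delta 2 x,
        Pi.single_eq_of_ne hyx, mul_zero, sub_zero, norm_mul, norm_mul, norm_inv,
        Complex.norm_real, Complex.norm_real, Real.norm_of_nonneg ht0.le,
        Real.norm_of_nonneg (G.m_pos y).le]
    rw [hself, Finset.sum_congr rfl hother, ← Finset.mul_sum, ← mul_add, mul_left_comm]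
    refine mul_le_mul_of_nonneg_left ?_ (inv_pos.2 ht0).le
    -- At x the real part replaces the modulus, being linear and hence compatible with subtracting
    -- δ.
    have hre := mul_le_mul_of_nonneg_left (Complex.re_le_norm (S₂ t (G.delta 2 x) x))
      (G.m_pos x).le
    linarith
  rw [le_div_iff₀ (G.m_pos x)]
  linarith
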